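/- Let $\mathcal{O}$ be a discrete valuation ring with field of fractions $K$ and maximal ideal $\mathfrak{m}=\mathcal{O}\pi$ ($K$ need not be complete, and the residue field is arbitrary). A lattice in $K^2$ is a free $\mathcal{O}$-submodule of rank $2$; its homothety class is $[L]=\{cL : c\in K\setminus\{0\}\}$, and $\mathcal{B}_2^0(K)$ denotes the set of all classes $[L]$ (the vertices of the Bruhat–Tits tree). For classes $[L_1],[L_2]$ let $\operatorname{dist}([L_1],[L_2])$ be the least integer $s\ge 0$ such that $\pi^sL_1'\subseteq L_2'\subseteq L_1'$ for some $L_1'\in[L_1]$, $L_2'\in[L_2]$; for a non-empty set $\mathcal{L}$ of classes let $\operatorname{dist}([L],\mathcal{L})=\min_{[L']\in\mathcal{L}}\operatorname{dist}([L],[L'])$. An $\mathcal{O}$-order in $K^{2\times2}$ is a subring $\Lambda$ containing the identity matrix that is a free $\mathcal{O}$-submodule of rank $4$, and $Q(\Lambda)=\{[L]\in\mathcal{B}_2^0(K) : \Lambda L=L\}$. A subset of $\mathcal{B}_2^0(K)$ is called PZ-closed if it equals $Q(\Lambda)$ for some $\mathcal{O}$-order $\Lambda$ in $K^{2\times2}$.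 For a basis $e=(e_1,e_2)$ of $K^2$ and a matrix $M\in\mathbb{Z}^{2\times2}$ with $M_{ii}=0$ and $M_{ij}+M_{jk}\ge M_{ik}$ for all $i,j,k$, let $\Lambda_e(M)$ be the order of all $X\in K^{2\times2}$ whose matrix with respect to the basis $e$ has $(i,j)$ entry in $\mathfrak{m}^{M_{ij}}$ for all $i,j$. A bolytrope is a set of the form $$\{[L]\in\mathcal{B}_2^0(K) : \operatorname{dist}([L],Q(\Lambda_e(M)))\le r\}$$ for some such $e$ and $M$ and some integer $r\ge0$. Then a subset of $\mathcal{B}_2^0(K)$ is PZ-closed if and only if it is a bolytrope. -/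

import Mathlib

open scoped Pointwise nonZeroDivisors

namespace BolytropeOrders

section

variable (O : Type*) [CommRing O] [IsDomain O] [IsDiscreteValuationRing O]
variable (K : Type*) [Field K] [Algebra O K] [IsFractionRing O K]
variable (d : ℕ)

/-- The `O`-lattices in `K ^ d`. A finitely generated `O`-submodule of `K ^ d` that spans `K ^ d`
is the same as a free `O`-submodule of rank `d`, since `O` is a principal ideal domain with field
of fractions `K`. -/
abbrev Lattice : Type _ :=
  {L : Submodule O (Fin d → K) // Submodule.IsLattice K L}

/-- Homothety: `L₂ = c L₁` for some `c ∈ K \ {0}`. -/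
def homothety : Setoid (Lattice O K d) where
  r L₁ L₂ := ∃ c : Kˣ, L₂.1 = c • L₁.1
  iseqv :=
    { refl := fun L => ⟨1, (one_smul _ _).symm⟩
      symm := by
        rintro L₁ L₂ ⟨c, hc⟩
        exact ⟨c⁻¹, by rw [hc, inv_smul_smul]⟩
      trans := by
        rintro L₁ L₂ L₃ ⟨c, hc⟩ ⟨c', hc'⟩
        exact ⟨c' * c, by rw [hc', hc, mul_smul]⟩ }

/-- The vertex set of the affine building: homothety classes `[L]` of lattices in `K ^ d`. -/
abbrev Vertex : Type _ := Quotient (homothety O K d)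

variable {O K d}

/-- The class `[L]` of a lattice `L`. -/
def Lattice.cls (L : Lattice O K d) : Vertex O K d := Quotient.mk (homothety O K d) L

/-- `dist v w` is the least `s` for which there are representatives `L₁` of `v` and `L₂` of `w`
with `π ^ s L₁ ⊆ L₂ ⊆ L₁`; here `π ^ s L₁ = 𝔪 ^ s L₁` for every uniformizer `π`. -/
noncomputable def dist (v w : Vertex O K d) : ℕ :=
  sInf {s : ℕ | ∃ L₁ L₂ : Lattice O K d, L₁.cls = v ∧ L₂.cls = w ∧
    IsLocalRing.maximalIdeal O ^ s • L₁.1 ≤ L₂.1 ∧ L₂.1 ≤ L₁.1}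

/-- The distance from a vertex to a set of vertices (infinite for the empty set). -/
noncomputable def distSet (v : Vertex O K d) (S : Set (Vertex O K d)) : ℕ∞ :=
  ⨅ w ∈ S, (dist v w : ℕ∞)

/-- The closed ball of radius `r` around a set of vertices. -/
def closedBall (r : ℕ) (S : Set (Vertex O K d)) : Set (Vertex O K d) :=
  {v | distSet v S ≤ r}

/-- An `O`-subalgebra of the matrix ring `K ^ (d × d)` is an `O`-order if it is an `O`-lattice. -/
def IsOrder (Λ : Subalgebra O (Matrix (Fin d) (Fin d) K)) : Prop :=
  Submodule.IsLattice K (Subalgebra.toSubmodule Λ)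

/-- `L` is a `Λ`-lattice, that is, a lattice that is also a `Λ`-module. As `1 ∈ Λ`, this is the
same as `Λ L = L`. -/
def IsInvariant (Λ : Subalgebra O (Matrix (Fin d) (Fin d) K)) (L : Lattice O K d) : Prop :=
  ∀ X ∈ Λ, ∀ x ∈ L.1, X.mulVec x ∈ L.1

/-- `Q(Λ)`, the set of homothety classes of `Λ`-lattices. -/
def invariantClasses (Λ : Subalgebra O (Matrix (Fin d) (Fin d) K)) : Set (Vertex O K d) :=
  {v | ∃ L : Lattice O K d, L.cls = v ∧ IsInvariant Λ L}

/-- A set of vertices is PZ-closed if it is `Q(Λ)` for some order `Λ`. -/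
def IsPZClosed (S : Set (Vertex O K d)) : Prop :=
  ∃ Λ : Subalgebra O (Matrix (Fin d) (Fin d) K), IsOrder Λ ∧ S = invariantClasses Λ

variable (O K) in
/-- The fractional ideal `𝔪 ^ n` of `K`, for an integer `n`. -/
noncomputable def maxPow (n : ℤ) : FractionalIdeal O⁰ K :=
  (IsLocalRing.maximalIdeal O : FractionalIdeal O⁰ K) ^ n

theorem maxPow_zero : maxPow O K 0 = 1 := zpow_zero _

theorem maxPow_mul_le {a b c : ℤ} (h : c ≤ a + b) :
    maxPow O K a * maxPow O K b ≤ maxPow O K c := by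
  have h0 : (IsLocalRing.maximalIdeal O : FractionalIdeal O⁰ K) ≠ 0 :=
    FractionalIdeal.coeIdeal_ne_zero.mpr (IsDiscreteValuationRing.not_a_field O)
  obtain ⟨n, hn⟩ := Int.eq_ofNat_of_zero_le (sub_nonneg.mpr h)
  have e : a + b = c + (n : ℤ) := by omega
  unfold maxPow
  rw [← zpow_add₀ h0, e, zpow_add₀ h0, zpow_natCast, ← FractionalIdeal.coeIdeal_pow]
  calc _ ≤ (IsLocalRing.maximalIdeal O : FractionalIdeal O⁰ K) ^ c * 1 :=
        mul_le_mul_right FractionalIdeal.coeIdeal_le_one _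
    _ = _ := mul_one _

/-- The set `𝒫_d(ℤ)` of exponent matrices. -/
def exponentMatrices (d : ℕ) : Set (Matrix (Fin d) (Fin d) ℤ) :=
  {M | (∀ i, M i i = 0) ∧ ∀ i j k, M i k ≤ M i j + M j k}

/-- The graduated order `Λ(M)` with respect to a basis `e` of `K ^ d`: all matrices `X` that,
written with respect to `e`, have their `(i, j)` entry in `𝔪 ^ (M i j)`. -/
noncomputable def graduatedOrder (e : Module.Basis (Fin d) K (Fin d → K))
    (M : Matrix (Fin d) (Fin d) ℤ) (hM : M ∈ exponentMatrices d) :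
    Subalgebra O (Matrix (Fin d) (Fin d) K) where
  carrier := {X | ∀ i j, LinearMap.toMatrix e e (Matrix.toLin' X) i j ∈ maxPow O K (M i j)}
  mul_mem' := by
    intro X Y hX hY i j
    rw [Matrix.toLin'_mul, LinearMap.toMatrix_comp e e e, Matrix.mul_apply]
    exact Submodule.sum_mem (maxPow O K (M i j) : Submodule O K) fun k _ =>
      maxPow_mul_le (hM.2 i k j) (FractionalIdeal.mul_mem_mul (hX i k) (hY k j))
  add_mem' := by
    intro X Y hX hY i j
    rw [map_add, map_add]
    exact Submodule.add_mem (maxPow O K (M i j) : Submodule O K) (hX i j) (hY i j)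
  algebraMap_mem' := by
    intro a i j
    have h : LinearMap.toMatrix e e (Matrix.toLin'
        (algebraMap O (Matrix (Fin d) (Fin d) K) a)) =
        algebraMap O K a • (1 : Matrix (Fin d) (Fin d) K) := by
      rw [IsScalarTower.algebraMap_apply O K, Algebra.algebraMap_eq_smul_one, map_smul, map_smul,
        Matrix.toLin'_one, LinearMap.toMatrix_id]
    rw [h, Matrix.smul_apply, Matrix.one_apply]
    split_ifs with hij
    · subst hij
      rw [hM.1, maxPow_zero, smul_eq_mul, mul_one]
      exact FractionalIdeal.coe_mem_one _ _
    · rw [smul_zero]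
      exact Submodule.zero_mem (maxPow O K (M i j) : Submodule O K)

/-- A bolytrope is a closed ball around `Q(Λ(M))`, where `Λ(M)` is the graduated order of an
exponent matrix `M` with respect to some basis of `K ^ d`. -/
def IsBolytrope (S : Set (Vertex O K d)) : Prop :=
  ∃ (e : Module.Basis (Fin d) K (Fin d → K)) (M : Matrix (Fin d) (Fin d) ℤ)
    (hM : M ∈ exponentMatrices d) (r : ℕ),
    S = closedBall r (invariantClasses (graduatedOrder (O := O) e M hM))

end

end BolytropeOrders

/-! A class [L] lies within r of Q(Λ) iff π^r ΛL ⊆ L, since ΛL is then an invariant lattice within r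
of L (`cls_mem_closedBall_iff`). So the ball is Q(O + π^r Λ), and bolytropes are PZ-closed.

Conversely, Q(Λ) is bounded (`exists_dist_bound`). Let L₁, L₂ realise its diameter D, in a basis e
with L₁ = Oe₀ + Oe₁ and L₂ = Oe₀ + π^D Oe₁ (`exists_adapted_basis`). Every X in Λ then has integral
entries and X₁₀ ∈ 𝔪^D. Let r ≤ D/2 be largest with X₀₀ - X₁₁ ∈ 𝔪^r on all of Λ, and M = (0, -r; D -
r, 0); Q(Λ(M)) is the path from [L₁] to [L₂] shortened by r at both ends. Since Λ ⊆ O + π^r Λ(M),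
the ball of radius r around this path lies in Q(Λ).

For the other inclusion, scale L in Q(Λ) so that it is spanned by ce₀ + e₁ and π^m e₀. Its distances
to L₁ and L₂ are at most D, which bounds m and c (`hermite_form_bounds`). Stability under π^r Λ(M)
then only needs cπ^r ∈ 𝔪^m (`mulVec_mem_of_hermite_form`). If D ≤ 2r + 1, this follows from c²π^D ∈
𝔪^m; otherwise some X in Λ has X₀₀ - X₁₁ of valuation exactly r, and X(ce₀ + e₁) ∈ L gives it. -/

set_option linter.unusedSectionVars false

open scoped Pointwise nonZeroDivisors

namespace BolytropeOrders

/-! ### Powers of the maximal ideal and valuations -/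

section Valuation

variable (O : Type*) [CommRing O] [IsDomain O] [IsDiscreteValuationRing O]
variable (K : Type*) [Field K] [Algebra O K] [IsFractionRing O K]

/-- A uniformizer of `O`, viewed in `K`. -/
noncomputable def unif : K :=
  algebraMap O K (IsDiscreteValuationRing.exists_irreducible O).choose

variable {O}

theorem unif_eq_algebraMap : ∃ π : O, Irreducible π ∧ unif O K = algebraMap O K π :=
  ⟨_, (IsDiscreteValuationRing.exists_irreducible O).choose_spec, rfl⟩

variable (O)

theorem unif_ne_zero : unif O K ≠ 0 := by
  obtain ⟨π, hπ, h⟩ := unif_eq_algebraMap (O := O) K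
  rw [h, Ne, IsFractionRing.to_map_eq_zero_iff]
  exact hπ.ne_zero

variable {O K}

theorem mem_maxPow {n : ℤ} {x : K} :
    x ∈ maxPow O K n ↔ ∃ a : O, x = algebraMap O K a * unif O K ^ n := by
  obtain ⟨π, hπ, h⟩ := unif_eq_algebraMap (O := O) K
  have key : maxPow O K n = FractionalIdeal.spanSingleton O⁰ (unif O K ^ n) := by
    rw [maxPow, hπ.maximalIdeal_eq, FractionalIdeal.coeIdeal_span_singleton, ← h]
    obtain ⟨k, rfl | rfl⟩ := n.eq_nat_or_neg
    · rw [zpow_natCast, zpow_natCast, FractionalIdeal.spanSingleton_pow]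
    · rw [zpow_neg, zpow_neg, zpow_natCast, zpow_natCast, FractionalIdeal.spanSingleton_pow,
        FractionalIdeal.spanSingleton_inv]
  rw [key, FractionalIdeal.mem_spanSingleton]
  simp only [Algebra.smul_def, eq_comm]

theorem unif_zpow_mem (n : ℤ) : unif O K ^ n ∈ maxPow O K n :=
  mem_maxPow.2 ⟨1, by simp⟩

theorem algebraMap_mem (a : O) : algebraMap O K a ∈ maxPow O K 0 :=
  mem_maxPow.2 ⟨a, by simp⟩

theorem mul_mem_maxPow {a b c : ℤ} {x y : K} (hx : x ∈ maxPow O K a) (hy : y ∈ maxPow O K b)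
    (h : c ≤ a + b) : x * y ∈ maxPow O K c :=
  maxPow_mul_le h (FractionalIdeal.mul_mem_mul hx hy)

theorem zero_mem_maxPow (n : ℤ) : (0 : K) ∈ maxPow O K n :=
  Submodule.zero_mem (maxPow O K n : Submodule O K)

theorem add_mem_maxPow {n : ℤ} {x y : K} (hx : x ∈ maxPow O K n) (hy : y ∈ maxPow O K n) :
    x + y ∈ maxPow O K n :=
  Submodule.add_mem (maxPow O K n : Submodule O K) hx hy

theorem sub_mem_maxPow {n : ℤ} {x y : K} (hx : x ∈ maxPow O K n) (hy : y ∈ maxPow O K n) :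
    x - y ∈ maxPow O K n :=
  Submodule.sub_mem (maxPow O K n : Submodule O K) hx hy

theorem one_mem_maxPow : (1 : K) ∈ maxPow O K 0 := by
  simpa using unif_zpow_mem (O := O) (K := K) 0

theorem maxPow_mono {m n : ℤ} (h : m ≤ n) {x : K} (hx : x ∈ maxPow O K n) :
    x ∈ maxPow O K m := by
  simpa using mul_mem_maxPow hx one_mem_maxPow (c := m) (by omega)

theorem zpow_mul_mem_iff {k n : ℤ} {x : K} :
    unif O K ^ k * x ∈ maxPow O K n ↔ x ∈ maxPow O K (n - k) := by
  constructor
  · intro h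
    have h2 := mul_mem_maxPow (unif_zpow_mem (O := O) (K := K) (-k)) h (c := n - k) (by omega)
    rwa [← mul_assoc, ← zpow_add₀ (unif_ne_zero O K), neg_add_cancel, zpow_zero, one_mul] at h2
  · intro h
    exact mul_mem_maxPow (unif_zpow_mem k) h (by omega)

theorem unif_zpow_mem_iff {k n : ℤ} : unif O K ^ k ∈ maxPow O K n ↔ n ≤ k := by
  refine ⟨fun h => ?_, fun h => maxPow_mono h (unif_zpow_mem k)⟩
  by_contra! hlt
  obtain ⟨π, hπ, hu⟩ := unif_eq_algebraMap (O := O) K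
  -- Shifting by -k - 1 would place π⁻¹ in O and make π a unit.
  have h1 := mul_mem_maxPow h (unif_zpow_mem (O := O) (K := K) (-k - 1)) (c := 0) (by omega)
  rw [← zpow_add₀ (unif_ne_zero O K), show k + (-k - 1) = -1 by ring, zpow_neg_one] at h1
  obtain ⟨a, ha⟩ := mem_maxPow.1 h1
  rw [zpow_zero, mul_one, hu] at ha
  have hp : algebraMap O K π ≠ 0 := hu ▸ unif_ne_zero O K
  have : π * a = 1 := by
    apply IsFractionRing.injective O K
    rw [map_mul, ← ha, mul_inv_cancel₀ hp, map_one]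
  exact hπ.not_isUnit (IsUnit.of_mul_eq_one _ this)

theorem exists_eq_unit_mul_zpow {x : K} (hx : x ≠ 0) :
    ∃ (u : Oˣ) (k : ℤ), x = algebraMap O K u * unif O K ^ k := by
  obtain ⟨π, hπ, hu⟩ := unif_eq_algebraMap (O := O) K
  obtain ⟨k, u, h⟩ := IsDiscreteValuationRing.exists_units_eq_smul_zpow_of_irreducible hπ hx
  exact ⟨u, k, by rw [hu, h, Units.smul_def, Algebra.smul_def]⟩

theorem unit_mul_mem_iff {n : ℤ} {x : K} (u : Oˣ) :
    algebraMap O K u * x ∈ maxPow O K n ↔ x ∈ maxPow O K n := by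
  constructor
  · intro h
    have h2 := mul_mem_maxPow (algebraMap_mem (K := K) (↑u⁻¹ : O)) h (c := n) (by omega)
    rwa [← mul_assoc, ← map_mul, Units.inv_mul, map_one, one_mul] at h2
  · intro h
    exact mul_mem_maxPow (algebraMap_mem _) h (by omega)

/-- Stands in for the valuation k of x, turning memberships into integer inequalities. -/
theorem exists_valuation {x : K} (hx : x ≠ 0) :
    ∃ k : ℤ, ∀ (n : ℤ) (y : K), x * y ∈ maxPow O K n ↔ y ∈ maxPow O K (n - k) := by
  obtain ⟨u, k, rfl⟩ := exists_eq_unit_mul_zpow (O := O) hx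
  exact ⟨k, fun n y => by rw [mul_assoc, unit_mul_mem_iff, zpow_mul_mem_iff]⟩

/-- With v the valuation of c, 2(v + r) + 1 ≥ 2v + D ≥ m ≥ 2m, and integrality upgrades this to v +
r ≥ m. -/
theorem mem_of_sq_mul_mem {c : K} {m D r : ℤ} (hm : m ≤ 0) (hr : D ≤ 2 * r + 1)
    (h : c * c * unif O K ^ D ∈ maxPow O K m) : c * unif O K ^ r ∈ maxPow O K m := by
  rcases eq_or_ne c 0 with rfl | hc
  · rw [zero_mul]; exact zero_mem_maxPow m
  · obtain ⟨k, hk⟩ := exists_valuation (O := O) hc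
    rw [mul_assoc, hk, hk, unif_zpow_mem_iff] at h
    rw [hk, unif_zpow_mem_iff]
    omega

/-- A nonzero finitely generated `O`-submodule of `K` is a power of the maximal ideal. -/
theorem exists_eq_maxPow {N : Submodule O K} (hfg : N.FG) (h0 : N ≠ ⊥) :
    ∃ n : ℤ, ∀ x, x ∈ N ↔ x ∈ maxPow O K n := by
  let I : FractionalIdeal O⁰ K := ⟨N, FractionalIdeal.isFractional_of_fg hfg⟩
  obtain ⟨g, hg⟩ := (FractionalIdeal.isPrincipal_iff I).1 inferInstance
  have hN : ∀ x, x ∈ N ↔ ∃ a : O, a • g = x := fun x => by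
    rw [← FractionalIdeal.mem_spanSingleton O⁰, ← hg]; rfl
  have hg0 : g ≠ 0 := by
    rintro rfl
    refine h0 (eq_bot_iff.2 fun x hx => ?_)
    obtain ⟨a, rfl⟩ := (hN x).1 hx
    simp
  obtain ⟨u, k, rfl⟩ := exists_eq_unit_mul_zpow (O := O) hg0
  refine ⟨k, fun x => ?_⟩
  rw [hN, mem_maxPow]
  constructor
  · rintro ⟨a, rfl⟩
    exact ⟨a * u, by rw [Algebra.smul_def, map_mul, mul_assoc]⟩
  · rintro ⟨a, rfl⟩
    refine ⟨a * ↑u⁻¹, ?_⟩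
    rw [Algebra.smul_def, ← mul_assoc, ← map_mul, mul_assoc, Units.inv_mul, mul_one]

end Valuation

/-! ### Commensurability of lattices -/

section Lattices

variable {O : Type*} [CommRing O] [IsDomain O] [IsDiscreteValuationRing O]
variable {K : Type*} [Field K] [Algebra O K] [IsFractionRing O K]
variable {V : Type*} [AddCommGroup V] [Module K V] [Module O V] [IsScalarTower O K V]

theorem smul_mem_of_mem_maxPow {N : Submodule O V} {a : K} (ha : a ∈ maxPow O K 0) {x : V}
    (hx : x ∈ N) : a • x ∈ N := by
  obtain ⟨b, rfl⟩ := mem_maxPow.1 ha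
  rw [zpow_zero, mul_one, algebraMap_smul]
  exact N.smul_mem b hx

theorem smul_mem_of_le {N : Submodule O V} {m n : ℤ} {a : K} (ha : a ∈ maxPow O K n) (h : m ≤ n)
    {x : V} (hx : unif O K ^ m • x ∈ N) : a • x ∈ N := by
  have : a • x = (unif O K ^ (-m) * a) • unif O K ^ m • x := by
    rw [smul_smul, mul_right_comm, ← zpow_add₀ (unif_ne_zero O K), neg_add_cancel, zpow_zero,
      one_mul]
  rw [this]
  exact smul_mem_of_mem_maxPow (zpow_mul_mem_iff.2 (maxPow_mono (by omega) ha)) hx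

theorem exists_zpow_smul_mem {N : Submodule O V} (hN : Submodule.span K (N : Set V) = ⊤) (x : V) :
    ∃ n : ℕ, unif O K ^ (n : ℤ) • x ∈ N := by
  have hx : x ∈ Submodule.span K (N : Set V) := hN ▸ Submodule.mem_top
  induction hx using Submodule.span_induction with
  | mem x h => exact ⟨0, by simpa using h⟩
  | zero => exact ⟨0, by simp⟩
  | add x y _ _ hx hy =>
    obtain ⟨n, hn⟩ := hx
    obtain ⟨m, hm⟩ := hy
    refine ⟨n + m, ?_⟩
    rw [smul_add]
    exact N.add_mem (smul_mem_of_le (unif_zpow_mem _) (by omega) hn)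
      (smul_mem_of_le (unif_zpow_mem _) (by omega) hm)
  | smul c x _ hx =>
    obtain ⟨n, hn⟩ := hx
    rcases eq_or_ne c 0 with rfl | hc
    · exact ⟨0, by simp⟩
    · obtain ⟨u, k, rfl⟩ := exists_eq_unit_mul_zpow (O := O) hc
      refine ⟨n + k.natAbs, ?_⟩
      rw [smul_smul]
      refine smul_mem_of_le (n := ((n + k.natAbs : ℕ) : ℤ) + k) ?_ (by omega) hn
      rw [mul_left_comm, unit_mul_mem_iff, ← zpow_add₀ (unif_ne_zero O K)]
      exact unif_zpow_mem _

/-- Makes distances finite and, applied to an order, provides multiples of the matrix units in it.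
-/
theorem exists_zpow_smul_mem_of_fg {N P : Submodule O V}
    (hN : Submodule.span K (N : Set V) = ⊤) (hP : P.FG) :
    ∃ n : ℕ, ∀ x ∈ P, unif O K ^ (n : ℤ) • x ∈ N := by
  induction P, hP using Submodule.fg_induction with
  | singleton x =>
    obtain ⟨n, hn⟩ := exists_zpow_smul_mem hN x
    refine ⟨n, fun y hy => ?_⟩
    obtain ⟨a, rfl⟩ := Submodule.mem_span_singleton.1 hy
    rw [smul_comm]
    exact N.smul_mem a hn
  | sup P Q _ _ hP hQ =>
    obtain ⟨n, hn⟩ := hP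
    obtain ⟨m, hm⟩ := hQ
    refine ⟨n + m, fun x hx => ?_⟩
    obtain ⟨y, hy, z, hz, rfl⟩ := Submodule.mem_sup.1 hx
    rw [smul_add]
    exact N.add_mem (smul_mem_of_le (unif_zpow_mem _) (by omega) (hn y hy))
      (smul_mem_of_le (unif_zpow_mem _) (by omega) (hm z hz))

end Lattices

/-! ### Distance of classes and balls around Q(Λ) -/

section Distance

variable {O : Type*} [CommRing O] [IsDomain O] [IsDiscreteValuationRing O]
variable {K : Type*} [Field K] [Algebra O K] [IsFractionRing O K]
variable {d : ℕ}

theorem zpow_smul_zpow_smul {V : Type*} [AddCommGroup V] [Module K V] (m n : ℤ) (x : V) :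
    unif O K ^ m • unif O K ^ n • x = unif O K ^ (m + n) • x := by
  rw [smul_smul, zpow_add₀ (unif_ne_zero O K)]

theorem maximalIdeal_pow_smul_le_iff {s : ℕ} {N P : Submodule O (Fin d → K)} :
    IsLocalRing.maximalIdeal O ^ s • N ≤ P ↔ ∀ x ∈ N, unif O K ^ (s : ℤ) • x ∈ P := by
  obtain ⟨π, hπ, hu⟩ := unif_eq_algebraMap (O := O) K
  have e : ∀ x : Fin d → K, unif O K ^ (s : ℤ) • x = π ^ s • x := fun x => by
    rw [hu, zpow_natCast, ← map_pow, algebraMap_smul]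
  rw [hπ.maximalIdeal_eq, Ideal.span_singleton_pow, Submodule.ideal_span_singleton_smul]
  constructor
  · intro h x hx
    rw [e]
    exact h (Submodule.smul_mem_pointwise_smul _ _ _ hx)
  · rintro h _ ⟨x, hx, rfl⟩
    have := h x hx
    rwa [e] at this

theorem mem_units_smul_iff {N : Submodule O (Fin d → K)} {c : Kˣ} {x : Fin d → K} :
    x ∈ c • N ↔ c⁻¹ • x ∈ N := by
  constructor
  · rintro ⟨y, hy, rfl⟩
    change c⁻¹ • c • y ∈ N
    rwa [inv_smul_smul]
  · intro h
    exact ⟨_, h, smul_inv_smul c x⟩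

/-- The lattice `π ^ k L`. -/
noncomputable def Lattice.scale (L : Lattice O K d) (k : ℤ) : Lattice O K d :=
  ⟨(Units.mk0 (unif O K) (unif_ne_zero O K) ^ k) • L.1,
    haveI := L.2
    inferInstance⟩

theorem Lattice.mem_scale {L : Lattice O K d} {k : ℤ} {x : Fin d → K} :
    x ∈ (L.scale k).1 ↔ unif O K ^ (-k) • x ∈ L.1 := by
  rw [Lattice.scale, mem_units_smul_iff, ← zpow_neg, Units.smul_def, Units.val_zpow_eq_zpow_val,
    Units.val_mk0]

theorem Lattice.cls_scale (L : Lattice O K d) (k : ℤ) : (L.scale k).cls = L.cls :=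
  (Quotient.sound (s := homothety O K d) ⟨_, rfl⟩ : L.cls = (L.scale k).cls).symm

/-- The unit part of a homothety factor preserves every O-submodule, so only a power of π survives.
-/
theorem exists_zpow_of_cls_eq {L₁ L₂ : Lattice O K d} (h : L₁.cls = L₂.cls) :
    ∃ k : ℤ, ∀ x, x ∈ L₂.1 ↔ unif O K ^ k • x ∈ L₁.1 := by
  obtain ⟨c, hc⟩ := Quotient.exact h
  obtain ⟨u, k, hk⟩ := exists_eq_unit_mul_zpow (O := O) (c⁻¹).ne_zero
  refine ⟨k, fun x => ?_⟩
  rw [hc, mem_units_smul_iff, Units.smul_def, hk, mul_smul, algebraMap_smul]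
  exact L₁.1.smul_mem_iff_of_isUnit u.isUnit

theorem IsInvariant.of_cls_eq {Λ : Subalgebra O (Matrix (Fin d) (Fin d) K)}
    {L₁ L₂ : Lattice O K d} (h₁ : IsInvariant Λ L₁) (h : L₁.cls = L₂.cls) : IsInvariant Λ L₂ := by
  obtain ⟨k, hk⟩ := exists_zpow_of_cls_eq h
  intro X hX x hx
  rw [hk, ← Matrix.mulVec_smul]
  exact h₁ X hX _ ((hk x).1 hx)

theorem cls_mem_invariantClasses_iff {Λ : Subalgebra O (Matrix (Fin d) (Fin d) K)}
    {L : Lattice O K d} : L.cls ∈ invariantClasses Λ ↔ IsInvariant Λ L :=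
  ⟨fun ⟨_, h, h'⟩ => h'.of_cls_eq h, fun h => ⟨L, rfl, h⟩⟩

theorem mem_dist_set_of_zpow_smul_mem {L₁ L₂ : Lattice O K d} {s : ℕ} {t : ℤ}
    (h₁ : ∀ x ∈ L₂.1, unif O K ^ t • x ∈ L₁.1)
    (h₂ : ∀ x ∈ L₁.1, unif O K ^ (s - t) • x ∈ L₂.1) :
    s ∈ {s : ℕ | ∃ N₁ N₂ : Lattice O K d, N₁.cls = L₁.cls ∧ N₂.cls = L₂.cls ∧
      IsLocalRing.maximalIdeal O ^ s • N₁.1 ≤ N₂.1 ∧ N₂.1 ≤ N₁.1} := by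
  refine ⟨L₁, L₂.scale t, rfl, L₂.cls_scale t, ?_, ?_⟩
  · rw [maximalIdeal_pow_smul_le_iff]
    intro x hx
    rw [Lattice.mem_scale, zpow_smul_zpow_smul, neg_add_eq_sub]
    exact h₂ x hx
  · intro x hx
    have := h₁ _ (Lattice.mem_scale.1 hx)
    rwa [zpow_smul_zpow_smul, add_neg_cancel, zpow_zero, one_smul] at this

/-- Two classes are at distance at most `s` iff fixed representatives satisfy
`π ^ s L₁ ⊆ π ^ t L₂ ⊆ L₁` for some integer `t`. -/
theorem dist_cls_le_iff {L₁ L₂ : Lattice O K d} {s : ℕ} :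
    dist L₁.cls L₂.cls ≤ s ↔ ∃ t : ℤ, (∀ x ∈ L₂.1, unif O K ^ t • x ∈ L₁.1) ∧
      ∀ x ∈ L₁.1, unif O K ^ (s - t) • x ∈ L₂.1 := by
  constructor
  · intro h
    -- Commensurability makes the set of admissible s nonempty, so its infimum is attained and is
    -- not the default value of `sInf ∅`.
    obtain ⟨n, hn⟩ := exists_zpow_smul_mem_of_fg (K := K) L₁.2.span_eq_top L₂.2.fg
    obtain ⟨m, hm⟩ := exists_zpow_smul_mem_of_fg (K := K) L₂.2.span_eq_top L₁.2.fg
    have hne := mem_dist_set_of_zpow_smul_mem (s := n + m) (t := n) hn (by simpa using hm)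
    obtain ⟨N₁, N₂, h₁, h₂, h₃, h₄⟩ := Nat.sInf_mem ⟨_, hne⟩
    obtain ⟨k₁, hk₁⟩ := exists_zpow_of_cls_eq h₁.symm
    obtain ⟨k₂, hk₂⟩ := exists_zpow_of_cls_eq h₂.symm
    rw [maximalIdeal_pow_smul_le_iff] at h₃
    refine ⟨k₁ - k₂, fun x hx => ?_, fun x hx => ?_⟩
    · have : unif O K ^ (-k₂) • x ∈ N₂.1 := by
        rwa [hk₂, zpow_smul_zpow_smul, add_neg_cancel, zpow_zero, one_smul]
      have := h₄ this
      rwa [hk₁, zpow_smul_zpow_smul, ← sub_eq_add_neg] at this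
    · have : unif O K ^ (-k₁) • x ∈ N₁.1 := by
        rwa [hk₁, zpow_smul_zpow_smul, add_neg_cancel, zpow_zero, one_smul]
      have := h₃ _ this
      rw [hk₂, zpow_smul_zpow_smul, zpow_smul_zpow_smul] at this
      refine smul_mem_of_le (unif_zpow_mem _) ?_ this
      change k₂ + ((dist L₁.cls L₂.cls : ℕ) : ℤ) + -k₁ ≤ _
      omega
  · rintro ⟨t, h₁, h₂⟩
    exact Nat.sInf_le (mem_dist_set_of_zpow_smul_mem h₁ h₂)

theorem distSet_le_iff {v : Vertex O K d} {S : Set (Vertex O K d)} {r : ℕ} :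
    distSet v S ≤ r ↔ ∃ w ∈ S, dist v w ≤ r := by
  constructor
  · intro h
    by_contra! hlt
    have : ((r + 1 : ℕ) : ℕ∞) ≤ distSet v S :=
      le_iInf₂ fun w hw => Nat.cast_le.2 (hlt w hw)
    have := Nat.cast_le.1 (this.trans h)
    omega
  · rintro ⟨w, hw, h⟩
    exact (iInf₂_le w hw).trans (Nat.cast_le.2 h)

/-- The lattice `Λ L` generated by a lattice `L` under an order `Λ`. -/
theorem exists_invariant_lattice {Λ : Subalgebra O (Matrix (Fin d) (Fin d) K)}
    (hΛ : (Subalgebra.toSubmodule Λ).FG) (L : Lattice O K d) :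
    ∃ L' : Lattice O K d, IsInvariant Λ L' ∧ L.1 ≤ L'.1 ∧
      ∀ N : Submodule O (Fin d → K), (∀ X ∈ Λ, ∀ x ∈ L.1, X.mulVec x ∈ N) → L'.1 ≤ N := by
  let B : Matrix (Fin d) (Fin d) K →ₗ[O] (Fin d → K) →ₗ[O] (Fin d → K) :=
    LinearMap.mk₂ O (fun X x => X.mulVec x) (fun _ _ _ => Matrix.add_mulVec _ _ _)
      (fun _ _ _ => Matrix.smul_mulVec _ _ _) (fun _ _ _ => Matrix.mulVec_add _ _ _)
      (fun _ _ _ => Matrix.mulVec_smul _ _ _)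
  have hle : L.1 ≤ Submodule.map₂ B (Subalgebra.toSubmodule Λ) L.1 := fun x hx => by
    have := Submodule.apply_mem_map₂ B ((Subalgebra.mem_toSubmodule Λ).2 (one_mem Λ)) hx
    simpa [B] using this
  have := L.2
  refine ⟨⟨_, Submodule.IsLattice.of_le_of_isLattice_of_fg K hle (hΛ.map₂ B L.2.fg)⟩, ?_, hle, ?_⟩
  · intro X hX x hx
    have h : Submodule.map₂ B (Subalgebra.toSubmodule Λ) L.1 ≤
        (Submodule.map₂ B (Subalgebra.toSubmodule Λ) L.1).comap (B X) := by
      refine Submodule.map₂_le.2 fun Y hY y hy => ?_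
      have := Submodule.apply_mem_map₂ B ((Subalgebra.mem_toSubmodule Λ).2
        (mul_mem hX ((Subalgebra.mem_toSubmodule Λ).1 hY))) hy
      simpa [B, Matrix.mulVec_mulVec] using this
    exact h hx
  · intro N hN
    exact Submodule.map₂_le.2 hN

/-- The ball of radius `r` around `Q(Λ)` consists of the classes invariant under `π ^ r Λ`. -/
theorem cls_mem_closedBall_iff {Λ : Subalgebra O (Matrix (Fin d) (Fin d) K)}
    (hΛ : (Subalgebra.toSubmodule Λ).FG) {L : Lattice O K d} {r : ℕ} :
    L.cls ∈ closedBall r (invariantClasses Λ) ↔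
      ∀ X ∈ Λ, ∀ x ∈ L.1, unif O K ^ (r : ℤ) • X.mulVec x ∈ L.1 := by
  change distSet _ _ ≤ _ ↔ _
  rw [distSet_le_iff]
  constructor
  · rintro ⟨_, ⟨L', rfl, hL'⟩, h⟩ X hX x hx
    obtain ⟨t, h₁, h₂⟩ := dist_cls_le_iff.1 h
    -- π^r ΛL = π^t Λ(π^(r-t) L) ⊆ π^t L' ⊆ L.
    have := h₁ _ (hL' X hX _ (h₂ x hx))
    rwa [Matrix.mulVec_smul, zpow_smul_zpow_smul, add_sub_cancel] at this
  · intro h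
    obtain ⟨L', hinv, hle, hmin⟩ := exists_invariant_lattice hΛ L
    -- For L' = ΛL the shift is t = r: π^r ΛL ⊆ L ⊆ ΛL.
    refine ⟨_, ⟨L', rfl, hinv⟩, dist_cls_le_iff.2 ⟨r, ?_, ?_⟩⟩
    · have := hmin (L.scale (-r)).1 fun X hX x hx => by
        rw [Lattice.mem_scale, neg_neg]
        exact h X hX x hx
      intro x hx
      simpa [Lattice.mem_scale] using this hx
    · intro x hx
      simpa using hle hx

end Distance

/-! ### Bolytropes are PZ-closed -/

section Orders

variable {O : Type*} [CommRing O] [IsDomain O] [IsDiscreteValuationRing O]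
variable {K : Type*} [Field K] [Algebra O K] [IsFractionRing O K]
variable {d : ℕ}

theorem isOrder_graduatedOrder (e : Module.Basis (Fin d) K (Fin d → K))
    (M : Matrix (Fin d) (Fin d) ℤ) (hM : M ∈ exponentMatrices d) :
    IsOrder (graduatedOrder (O := O) e M hM) := by
  let φ : Matrix (Fin d) (Fin d) K ≃ₗ[K] Matrix (Fin d) (Fin d) K :=
    Matrix.toLin'.trans (LinearMap.toMatrix e e)
  let g : Fin d × Fin d → Matrix (Fin d) (Fin d) K := fun p =>
    φ.symm (Matrix.single p.1 p.2 (unif O K ^ M p.1 p.2))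
  have hg : ∀ p, g p ∈ graduatedOrder (O := O) e M hM := fun p i j => by
    change φ (g p) i j ∈ _
    rw [LinearEquiv.apply_symm_apply, Matrix.single_apply]
    split_ifs with h
    · rw [h.1, h.2]
      exact unif_zpow_mem _
    · exact zero_mem_maxPow _
  have hsum : ∀ X, X = ∑ i, ∑ j, (φ X i j * unif O K ^ (-M i j)) • g (i, j) := fun X => by
    apply φ.injective
    conv_lhs => rw [Matrix.matrix_eq_sum_single (φ X)]
    simp only [map_sum, map_smul, g, LinearEquiv.apply_symm_apply, Matrix.smul_single, smul_eq_mul]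
    refine Finset.sum_congr rfl fun i _ => Finset.sum_congr rfl fun j _ => ?_
    rw [mul_assoc, ← zpow_add₀ (unif_ne_zero O K), neg_add_cancel, zpow_zero, mul_one]
  refine ⟨?_, eq_top_iff.2 fun X _ => ?_⟩
  · have hle : Subalgebra.toSubmodule (graduatedOrder (O := O) e M hM) ≤
        Submodule.span O (Set.range g) := by
      intro X hX
      rw [hsum X]
      refine Submodule.sum_mem _ fun i _ => Submodule.sum_mem _ fun j _ => ?_
      refine smul_mem_of_mem_maxPow ?_ (Submodule.subset_span ⟨_, rfl⟩)
      exact mul_mem_maxPow (hX i j) (unif_zpow_mem _) (by omega)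
    exact (Submodule.fg_span (Set.finite_range g)).of_le hle
  · rw [hsum X]
    exact Submodule.sum_mem _ fun i _ => Submodule.sum_mem _ fun j _ =>
      Submodule.smul_mem _ _ (Submodule.subset_span (hg _))

/-- Balls around PZ-closed sets are PZ-closed: the ball of radius `r` around `Q(Λ)` is
`Q(O + π ^ r Λ)`. -/
theorem isPZClosed_closedBall {Λ : Subalgebra O (Matrix (Fin d) (Fin d) K)} (hΛ : IsOrder Λ)
    (r : ℕ) : IsPZClosed (closedBall r (invariantClasses Λ)) := by
  let Γ : Subalgebra O (Matrix (Fin d) (Fin d) K) :=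
    Algebra.adjoin O ((fun X => unif O K ^ (r : ℤ) • X) '' (Λ : Set (Matrix (Fin d) (Fin d) K)))
  have hmem : ∀ X ∈ Λ, unif O K ^ (r : ℤ) • X ∈ Γ := fun X hX =>
    Algebra.subset_adjoin ⟨X, hX, rfl⟩
  -- Γ ⊆ Λ yields finite generation, and π^r Λ ⊆ Γ yields full rank.
  have hle : Γ ≤ Λ := by
    refine Algebra.adjoin_le ?_
    rintro _ ⟨X, hX, rfl⟩
    exact smul_mem_of_mem_maxPow (N := Subalgebra.toSubmodule Λ)
      (maxPow_mono (by omega) (unif_zpow_mem (r : ℤ))) hX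
  refine ⟨Γ, ⟨hΛ.fg.of_le hle, eq_top_iff.2 ?_⟩, ?_⟩
  · rw [← hΛ.span_eq_top, Submodule.span_le]
    intro X hX
    have h1 : unif O K ^ (r : ℤ) • X ∈ Submodule.span K
        (Subalgebra.toSubmodule Γ : Set (Matrix (Fin d) (Fin d) K)) :=
      Submodule.subset_span (hmem X hX)
    have h := Submodule.smul_mem _ (unif O K ^ (-r : ℤ)) h1
    rwa [zpow_smul_zpow_smul, neg_add_cancel, zpow_zero, one_smul] at h
  · ext v
    obtain ⟨L, rfl⟩ := Quotient.exists_rep v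
    change L.cls ∈ _ ↔ L.cls ∈ _
    rw [cls_mem_closedBall_iff hΛ.fg, cls_mem_invariantClasses_iff]
    constructor
    · intro h X hX
      induction hX using Algebra.adjoin_induction with
      | mem X hX =>
        obtain ⟨Y, hY, rfl⟩ := hX
        intro x hx
        rw [Matrix.smul_mulVec]
        exact h Y hY x hx
      | algebraMap a =>
        intro x hx
        rw [Algebra.algebraMap_eq_smul_one, Matrix.smul_mulVec, Matrix.one_mulVec]
        exact L.1.smul_mem a hx
      | add X Y _ _ hX hY =>
        intro x hx
        rw [Matrix.add_mulVec]
        exact L.1.add_mem (hX x hx) (hY x hx)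
      | mul X Y _ _ hX hY =>
        intro x hx
        rw [← Matrix.mulVec_mulVec]
        exact hX _ (hY x hx)
    · intro h X hX x hx
      rw [← Matrix.smul_mulVec]
      exact h _ (hmem X hX) x hx

theorem IsBolytrope.isPZClosed {S : Set (Vertex O K d)} (h : IsBolytrope S) : IsPZClosed S := by
  obtain ⟨e, M, hM, r, rfl⟩ := h
  exact isPZClosed_closedBall (isOrder_graduatedOrder e M hM) r

end Orders

/-! ### Hermite form and adapted bases in the plane -/

section Plane

variable {O : Type*} [CommRing O] [IsDomain O] [IsDiscreteValuationRing O]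
variable {K : Type*} [Field K] [Algebra O K] [IsFractionRing O K]

theorem repr_add_zero {V : Type*} [AddCommGroup V] [Module K V] (e : Module.Basis (Fin 2) K V)
    (a b : K) : e.repr (a • e 0 + b • e 1) 0 = a := by simp

theorem repr_add_one {V : Type*} [AddCommGroup V] [Module K V] (e : Module.Basis (Fin 2) K V)
    (a b : K) : e.repr (a • e 0 + b • e 1) 1 = b := by simp

theorem repr_zpow_smul (e : Module.Basis (Fin 2) K (Fin 2 → K)) (n : ℤ) (x : Fin 2 → K)
    (i : Fin 2) : e.repr (unif O K ^ n • x) i = unif O K ^ n * e.repr x i := by simp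

/-- Hermite normal form of a lattice with respect to a basis. -/
theorem exists_hermite_form (e : Module.Basis (Fin 2) K (Fin 2 → K)) (L : Lattice O K 2) :
    ∃ (n m : ℤ) (c : K), ∀ x, x ∈ L.1 ↔
      e.repr x 1 ∈ maxPow O K n ∧ e.repr x 0 - c * e.repr x 1 ∈ maxPow O K m := by
  let f : Fin 2 → (Fin 2 → K) →ₗ[O] K := fun i => (e.coord i).restrictScalars O
  have hf : ∀ i x, f i x = e.repr x i := fun _ _ => rfl
  have hbot : ∀ (N : Submodule O (Fin 2 → K)) (i : Fin 2) (k : ℕ),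
      unif O K ^ (k : ℤ) • e i ∈ N → N.map (f i) ≠ ⊥ := by
    intro N i k hk h0
    have := Submodule.mem_map_of_mem (f := f i) hk
    rw [h0, Submodule.mem_bot, hf, repr_zpow_smul, e.repr_self, Finsupp.single_eq_same,
      mul_one] at this
    exact zpow_ne_zero _ (unif_ne_zero O K) this
  -- L is an extension of its second projection 𝔪^n by L₀ = L ∩ Ke₀, which is 𝔪^m e₀. A lift l of
  -- π^n splits it, and c is the slope l₀π^(-n).
  let L₀ : Submodule O (Fin 2 → K) := L.1 ⊓ LinearMap.ker (f 1)
  have hL₀ : L₀.FG := L.2.fg.of_le inf_le_left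
  obtain ⟨k₀, hk₀⟩ := exists_zpow_smul_mem (K := K) L.2.span_eq_top (e 0)
  obtain ⟨k₁, hk₁⟩ := exists_zpow_smul_mem (K := K) L.2.span_eq_top (e 1)
  obtain ⟨n, hn⟩ := exists_eq_maxPow (L.2.fg.map (f 1)) (hbot _ 1 k₁ hk₁)
  obtain ⟨m, hm⟩ := exists_eq_maxPow (hL₀.map (f 0)) (hbot L₀ 0 k₀ ⟨hk₀, by
    simp [hf]⟩)
  obtain ⟨l, hl, hl1⟩ := (hn _).2 (unif_zpow_mem n)
  rw [hf] at hl1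
  refine ⟨n, m, e.repr l 0 * unif O K ^ (-n), fun x => ?_⟩
  have hu : unif O K ^ (-n) * unif O K ^ n = 1 := by
    rw [← zpow_add₀ (unif_ne_zero O K), neg_add_cancel, zpow_zero]
  set a := unif O K ^ (-n) * e.repr x 1 with ha
  have h0 : e.repr (x - a • l) 0 = e.repr x 0 - e.repr l 0 * unif O K ^ (-n) * e.repr x 1 := by
    rw [map_sub, map_smul, Finsupp.sub_apply, Finsupp.smul_apply, smul_eq_mul, ha]
    ring
  have h1 : e.repr (x - a • l) 1 = 0 := by
    rw [map_sub, map_smul, Finsupp.sub_apply, Finsupp.smul_apply, smul_eq_mul, ha, hl1,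
      mul_right_comm, hu, one_mul, sub_self]
  have hal : e.repr x 1 ∈ maxPow O K n → a • l ∈ L.1 := fun h =>
    smul_mem_of_mem_maxPow (zpow_mul_mem_iff.2 (maxPow_mono (by omega) h)) hl
  rw [← h0]
  constructor
  · intro hx
    have hx1 : e.repr x 1 ∈ maxPow O K n := (hn _).1 ⟨x, hx, rfl⟩
    exact ⟨hx1, (hm _).1 ⟨_, ⟨L.1.sub_mem hx (hal hx1), h1⟩, rfl⟩⟩
  · rintro ⟨hx1, hx0⟩
    obtain ⟨y, ⟨hy, hy1⟩, hy0⟩ := (hm _).2 hx0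
    have : x = y + a • l := by
      rw [← sub_eq_iff_eq_add]
      refine e.repr.injective (Finsupp.ext fun i => ?_)
      fin_cases i
      · exact hy0.symm
      · exact h1.trans hy1.symm
    rw [this]
    exact L.1.add_mem hy (hal hx1)

theorem exists_scaled_hermite_form (e : Module.Basis (Fin 2) K (Fin 2 → K)) (L : Lattice O K 2) :
    ∃ L' : Lattice O K 2, L'.cls = L.cls ∧ ∃ (m : ℤ) (c : K), ∀ x, x ∈ L'.1 ↔
      e.repr x 1 ∈ maxPow O K 0 ∧ e.repr x 0 - c * e.repr x 1 ∈ maxPow O K m := by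
  obtain ⟨n, m, c, h⟩ := exists_hermite_form e L
  refine ⟨L.scale (-n), L.cls_scale _, m - n, c, fun x => ?_⟩
  rw [Lattice.mem_scale, h, neg_neg, repr_zpow_smul, repr_zpow_smul, zpow_mul_mem_iff, sub_self,
    mul_left_comm, ← mul_sub, zpow_mul_mem_iff]

/-- For a vector l with l₀ ≠ 0, the choice α = l₀⁻¹, β = l₁l₀⁻¹ makes l the first basis vector. -/
theorem exists_basis_repr_shear (f : Module.Basis (Fin 2) K (Fin 2 → K)) {α : K} (hα : α ≠ 0)
    (β : K) : ∃ e : Module.Basis (Fin 2) K (Fin 2 → K), ∀ x,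
      e.repr x 0 = α * f.repr x 0 ∧ e.repr x 1 = f.repr x 1 - β * f.repr x 0 := by
  let ψ : (Fin 2 → K) ≃ₗ[K] (Fin 2 → K) :=
    { toFun := fun v => ![α * v 0, v 1 - β * v 0]
      invFun := fun w => ![α⁻¹ * w 0, w 1 + β * (α⁻¹ * w 0)]
      map_add' := fun v w => by
        ext i
        fin_cases i <;> simp <;> ring
      map_smul' := fun a v => by
        ext i
        fin_cases i <;> simp <;> ring
      left_inv := fun v => by
        ext i
        fin_cases i <;> simp [hα]
      right_inv := fun v => by
        ext i
        fin_cases i <;> simp [hα] }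
  exact ⟨Module.Basis.ofEquivFun (f.equivFun.trans ψ), fun x => ⟨rfl, rfl⟩⟩

theorem exists_basis_of_lattice (L : Lattice O K 2) :
    ∃ f : Module.Basis (Fin 2) K (Fin 2 → K), ∀ x, x ∈ L.1 ↔
      f.repr x 0 ∈ maxPow O K 0 ∧ f.repr x 1 ∈ maxPow O K 0 := by
  have := L.2
  let b : Module.Basis (Fin 2) O L.1 := Module.finBasisOfFinrankEq O L.1
    (Submodule.IsLattice.finrank_of_pi K L.1)
  have hb : ∀ i, b.extendOfIsLattice K i ∈ L.1 := fun i => by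
    rw [Module.Basis.extendOfIsLattice_apply]
    exact (b i).2
  refine ⟨b.extendOfIsLattice K, fun x => ⟨fun hx => ?_, fun hx => ?_⟩⟩
  · have key : x = algebraMap O K (b.repr ⟨x, hx⟩ 0) • b.extendOfIsLattice K 0 +
        algebraMap O K (b.repr ⟨x, hx⟩ 1) • b.extendOfIsLattice K 1 := by
      have := congrArg Subtype.val (b.sum_repr ⟨x, hx⟩)
      rw [Fin.sum_univ_two] at this
      simp only [Module.Basis.extendOfIsLattice_apply, algebraMap_smul]
      exact this.symm
    rw [key, repr_add_zero, repr_add_one]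
    exact ⟨algebraMap_mem _, algebraMap_mem _⟩
  · rw [← (b.extendOfIsLattice K).sum_repr x, Fin.sum_univ_two]
    exact L.1.add_mem (smul_mem_of_mem_maxPow hx.1 (hb 0)) (smul_mem_of_mem_maxPow hx.2 (hb 1))

/-- Elementary divisors: two lattices have a common adapted basis, and the exponent is the
distance of their classes. -/
theorem exists_adapted_basis (L₁ L₂ : Lattice O K 2) :
    ∃ (e : Module.Basis (Fin 2) K (Fin 2 → K)) (L : Lattice O K 2), L.cls = L₂.cls ∧
      (∀ x, x ∈ L₁.1 ↔ e.repr x 0 ∈ maxPow O K 0 ∧ e.repr x 1 ∈ maxPow O K 0) ∧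
      ∀ x, x ∈ L.1 ↔ e.repr x 0 ∈ maxPow O K 0 ∧
        e.repr x 1 ∈ maxPow O K (dist L₁.cls L₂.cls : ℕ) := by
  obtain ⟨t, ht₁, ht₂⟩ := dist_cls_le_iff.1 (le_refl (dist L₁.cls L₂.cls))
  set D := dist L₁.cls L₂.cls with hD
  let L := L₂.scale t
  have hcls : L.cls = L₂.cls := L₂.cls_scale t
  have hle : ∀ x ∈ L.1, x ∈ L₁.1 := fun x hx => by
    have := ht₁ _ (Lattice.mem_scale.1 hx)
    rwa [zpow_smul_zpow_smul, add_neg_cancel, zpow_zero, one_smul] at this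
  have hge : ∀ x ∈ L₁.1, unif O K ^ (D : ℤ) • x ∈ L.1 := fun x hx => by
    rw [Lattice.mem_scale, zpow_smul_zpow_smul, neg_add_eq_sub]
    exact ht₂ x hx
  have hmin : ∀ (s : ℕ) (k : ℤ), (∀ x ∈ L.1, unif O K ^ k • x ∈ L₁.1) →
      (∀ x ∈ L₁.1, unif O K ^ (s - k) • x ∈ L.1) → D ≤ s := fun s k h h' => by
    rw [hD, ← hcls]
    exact dist_cls_le_iff.2 ⟨k, h, h'⟩
  -- Some l in L is primitive in L₁, for otherwise L ⊆ πL₁; swapping the basis vectors if necessary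
  -- makes its first coordinate a unit.
  obtain ⟨f, l, hf, hl, hl0⟩ : ∃ (f : Module.Basis (Fin 2) K (Fin 2 → K)) (l : Fin 2 → K),
      (∀ x, x ∈ L₁.1 ↔ f.repr x 0 ∈ maxPow O K 0 ∧ f.repr x 1 ∈ maxPow O K 0) ∧
      l ∈ L.1 ∧ f.repr l 0 ∉ maxPow O K 1 := by
    obtain ⟨f, hf⟩ := exists_basis_of_lattice L₁
    by_cases h0 : ∃ l ∈ L.1, f.repr l 0 ∉ maxPow O K 1
    · obtain ⟨l, hl, h⟩ := h0
      exact ⟨f, l, hf, hl, h⟩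
    by_cases h1 : ∃ l ∈ L.1, f.repr l 1 ∉ maxPow O K 1
    · obtain ⟨l, hl, h⟩ := h1
      refine ⟨f.reindex (Equiv.swap 0 1), l, fun x => ?_, hl, ?_⟩
      · rw [hf, and_comm]
        simp
      · simpa using h
    push Not at h0 h1
    have hdiv : ∀ x ∈ L.1, unif O K ^ (-1 : ℤ) • x ∈ L₁.1 := fun x hx => by
      rw [hf, repr_zpow_smul, repr_zpow_smul, zpow_mul_mem_iff, zpow_mul_mem_iff]
      exact ⟨maxPow_mono (by omega) (h0 x hx), maxPow_mono (by omega) (h1 x hx)⟩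
    exfalso
    -- D = 0 would give L₁ ⊆ L ⊆ πL₁; for D > 0, π⁻¹L lies between π^(D-1) L₁ and L₁, against the
    -- minimality of D.
    rcases Nat.eq_zero_or_pos D with h | h
    · have hf0 : f 0 ∈ L₁.1 := by
        rw [hf]
        simp [one_mem_maxPow, zero_mem_maxPow]
      have := h0 _ (hge _ hf0)
      rw [repr_zpow_smul, f.repr_self, Finsupp.single_eq_same, mul_one, unif_zpow_mem_iff] at this
      omega
    · have := hmin (D - 1) (-1) hdiv fun x hx => by
        rw [show ((D - 1 : ℕ) : ℤ) - -1 = D by omega]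
        exact hge x hx
      omega
  have hl₁ := (hf l).1 (hle l hl)
  have hne : f.repr l 0 ≠ 0 := fun h => hl0 (h ▸ zero_mem_maxPow 1)
  obtain ⟨u, k, hu⟩ := exists_eq_unit_mul_zpow (O := O) hne
  have hk : k = 0 := by
    have h1 := hl₁.1
    rw [hu, unit_mul_mem_iff, unif_zpow_mem_iff] at h1 hl0
    omega
  rw [hk, zpow_zero, mul_one] at hu
  have huinv : algebraMap O K ↑u⁻¹ * algebraMap O K u = 1 := by
    rw [← map_mul, Units.inv_mul, map_one]
  have hu0 : algebraMap O K (↑u⁻¹ : O) ≠ 0 := left_ne_zero_of_mul_eq_one huinv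
  obtain ⟨e, he⟩ := exists_basis_repr_shear f hu0 (f.repr l 1 * algebraMap O K ↑u⁻¹)
  have heL₁ : ∀ x, x ∈ L₁.1 ↔ e.repr x 0 ∈ maxPow O K 0 ∧ e.repr x 1 ∈ maxPow O K 0 := by
    intro x
    rw [hf, (he x).1, (he x).2, unit_mul_mem_iff]
    refine and_congr_right fun hx0 => ?_
    have hm : f.repr l 1 * algebraMap O K ↑u⁻¹ * f.repr x 0 ∈ maxPow O K 0 :=
      mul_mem_maxPow (mul_mem_maxPow hl₁.2 (algebraMap_mem _) (c := 0) (by omega)) hx0 (by omega)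
    exact ⟨fun h => sub_mem_maxPow h hm, fun h => by simpa using add_mem_maxPow h hm⟩
  have hel0 : e.repr l 0 = 1 := by rw [(he l).1, hu, huinv]
  have hel1 : e.repr l 1 = 0 := by rw [(he l).2, hu, mul_assoc, huinv, mul_one, sub_self]
  refine ⟨e, L, hcls, heL₁, ?_⟩
  -- Since l = e₀ lies in L ⊆ L₁, this form has n = 0 and c ∈ 𝔪^j, so L is diagonal in e.
  obtain ⟨n, j, c, hform⟩ := exists_hermite_form (e.reindex (Equiv.swap 0 1)) L
  have hform' : ∀ x, x ∈ L.1 ↔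
      e.repr x 0 ∈ maxPow O K n ∧ e.repr x 1 - c * e.repr x 0 ∈ maxPow O K j := by
    intro x
    rw [hform]
    simp
  have hn : n = 0 := by
    have h1 := ((hform' l).1 hl).1
    rw [hel0, ← zpow_zero (unif O K), unif_zpow_mem_iff] at h1
    have h2 := hle (unif O K ^ n • e 0 + (c * unif O K ^ n) • e 1) ((hform' _).2 (by
      rw [repr_add_zero, repr_add_one, sub_self]
      exact ⟨unif_zpow_mem n, zero_mem_maxPow j⟩))
    rw [heL₁, repr_add_zero, unif_zpow_mem_iff] at h2
    omega
  subst hn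
  have hc : c ∈ maxPow O K j := by
    have := ((hform' l).1 hl).2
    rw [hel0, hel1] at this
    simpa using sub_mem_maxPow (zero_mem_maxPow j) this
  have hfinal : ∀ x, x ∈ L.1 ↔ e.repr x 0 ∈ maxPow O K 0 ∧ e.repr x 1 ∈ maxPow O K j := by
    intro x
    rw [hform']
    refine and_congr_right fun hx0 => ?_
    have hm : c * e.repr x 0 ∈ maxPow O K j := mul_mem_maxPow hc hx0 (by omega)
    exact ⟨fun h => by simpa using add_mem_maxPow h hm, fun h => sub_mem_maxPow h hm⟩
  have hj0 : 0 ≤ j := by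
    have := hle ((0 : K) • e 0 + unif O K ^ j • e 1) ((hfinal _).2 (by
      rw [repr_add_zero, repr_add_one]
      exact ⟨zero_mem_maxPow 0, unif_zpow_mem j⟩))
    rw [heL₁, repr_add_one, unif_zpow_mem_iff] at this
    exact this.2
  have hjD : j ≤ D := by
    have := hge ((0 : K) • e 0 + (1 : K) • e 1) ((heL₁ _).2 (by
      rw [repr_add_zero, repr_add_one]
      exact ⟨zero_mem_maxPow 0, one_mem_maxPow⟩))
    rw [hfinal, repr_zpow_smul, repr_zpow_smul, repr_add_one, mul_one, unif_zpow_mem_iff] at this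
    exact this.2
  have hDj : D ≤ j.toNat := hmin j.toNat 0 (fun x hx => by simpa using hle x hx) fun x hx => by
    rw [heL₁] at hx
    rw [hfinal, repr_zpow_smul, repr_zpow_smul, zpow_mul_mem_iff, zpow_mul_mem_iff]
    exact ⟨maxPow_mono (by omega) hx.1, maxPow_mono (by omega) hx.2⟩
  have : (D : ℤ) = j := by omega
  rw [this]
  exact hfinal

end Plane

/-! ### PZ-closed sets are bolytropes -/

section Main

variable {O : Type*} [CommRing O] [IsDomain O] [IsDiscreteValuationRing O]
variable {K : Type*} [Field K] [Algebra O K] [IsFractionRing O K]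

theorem exists_invariant {d : ℕ} {Λ : Subalgebra O (Matrix (Fin d) (Fin d) K)} (hΛ : IsOrder Λ) :
    ∃ L : Lattice O K d, IsInvariant Λ L := by
  have hlat : Submodule.IsLattice K
      (Submodule.span O (Set.range (Pi.basisFun K (Fin d)))) :=
    ⟨Submodule.fg_span (Set.finite_range _), by
      rw [Submodule.span_span_of_tower, (Pi.basisFun K (Fin d)).span_eq]⟩
  obtain ⟨L, hL, -⟩ := exists_invariant_lattice hΛ.fg ⟨_, hlat⟩
  exact ⟨L, hL⟩

/-- Λ contains π^N times each matrix unit. This traps a suitably scaled invariant lattice between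
π^N O² and π^(-N) O², and two such lattices are within 4N. -/
theorem exists_dist_bound {Λ : Subalgebra O (Matrix (Fin 2) (Fin 2) K)} (hΛ : IsOrder Λ) :
    ∃ B : ℕ, ∀ L₁ L₂ : Lattice O K 2, IsInvariant Λ L₁ → IsInvariant Λ L₂ →
      dist L₁.cls L₂.cls ≤ B := by
  obtain ⟨N, hN⟩ := exists_zpow_smul_mem_of_fg (K := K)
    (N := Subalgebra.toSubmodule Λ)
    (P := Submodule.span O (Set.range fun p : Fin 2 × Fin 2 => Matrix.single p.1 p.2 (1 : K)))
    hΛ.span_eq_top (Submodule.fg_span (Set.finite_range _))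
  have hunit : ∀ i j, unif O K ^ (N : ℤ) • Matrix.single i j (1 : K) ∈ Λ := fun i j =>
    hN _ (Submodule.subset_span ⟨(i, j), rfl⟩)
  let e := Pi.basisFun K (Fin 2)
  have key : ∀ L : Lattice O K 2, IsInvariant Λ L → ∃ L' : Lattice O K 2, L'.cls = L.cls ∧
      (∀ x ∈ L'.1, ∀ i, x i ∈ maxPow O K (-N)) ∧
      ∀ x, (∀ i, x i ∈ maxPow O K N) → x ∈ L'.1 := by
    intro L hL
    obtain ⟨L', hcls, m, c, h⟩ := exists_scaled_hermite_form e L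
    have hL' : IsInvariant Λ L' := hL.of_cls_eq hcls.symm
    simp only [e, Pi.basisFun_repr] at h
    have hupd : ∀ i j, ∀ x ∈ L'.1,
        unif O K ^ (N : ℤ) • Function.update (0 : Fin 2 → K) i (x j) ∈ L'.1 := by
      intro i j x hx
      have := hL' _ (hunit i j) x hx
      rwa [Matrix.smul_mulVec, Matrix.single_mulVec, one_mul] at this
    have hact₀ : ∀ j, ∀ x ∈ L'.1, unif O K ^ (N : ℤ) * x j ∈ maxPow O K m := fun j x hx => by
      simpa using ((h _).1 (hupd 0 j x hx)).2
    have hact₁ : ∀ j, ∀ x ∈ L'.1, unif O K ^ (N : ℤ) * x j ∈ maxPow O K 0 := fun j x hx => by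
      simpa using ((h _).1 (hupd 1 j x hx)).1
    have hact₂ : ∀ j, ∀ x ∈ L'.1, -(c * (unif O K ^ (N : ℤ) * x j)) ∈ maxPow O K m :=
      fun j x hx => by simpa using ((h _).1 (hupd 1 j x hx)).2
    -- The scaled matrix units send (c, 1) to π^N e₀ and π^N e₁, which therefore lie in L'.
    have hv : ![c, 1] ∈ L'.1 := by
      rw [h]
      simp [one_mem_maxPow, zero_mem_maxPow]
    have h₀ : unif O K ^ (N : ℤ) ∈ maxPow O K m := by simpa using hact₀ 1 _ hv
    have h₂ : c * unif O K ^ (N : ℤ) ∈ maxPow O K m := by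
      simpa using sub_mem_maxPow (zero_mem_maxPow m) (hact₂ 1 _ hv)
    refine ⟨L', hcls, fun x hx i => ?_, fun x hx => ?_⟩
    · have := hact₁ i x hx
      rwa [zpow_mul_mem_iff, zero_sub] at this
    · rw [h]
      refine ⟨maxPow_mono (by omega) (hx 1), ?_⟩
      obtain ⟨a, ha⟩ := mem_maxPow.1 (hx 0)
      obtain ⟨b, hb⟩ := mem_maxPow.1 (hx 1)
      have : x 0 - c * x 1 = algebraMap O K a * unif O K ^ (N : ℤ) -
          algebraMap O K b * (c * unif O K ^ (N : ℤ)) := by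
        rw [ha, hb]
        ring
      rw [this]
      exact sub_mem_maxPow (mul_mem_maxPow (algebraMap_mem a) h₀ (by omega))
        (mul_mem_maxPow (algebraMap_mem b) h₂ (by omega))
  refine ⟨4 * N, fun L₁ L₂ h₁ h₂ => ?_⟩
  obtain ⟨N₁, hcls₁, hlow₁, hup₁⟩ := key L₁ h₁
  obtain ⟨N₂, hcls₂, hlow₂, hup₂⟩ := key L₂ h₂
  rw [← hcls₁, ← hcls₂]
  refine dist_cls_le_iff.2 ⟨2 * N, fun x hx => hup₁ _ fun i => ?_, fun x hx => hup₂ _ fun i => ?_⟩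
  · rw [Pi.smul_apply, smul_eq_mul, zpow_mul_mem_iff]
    exact maxPow_mono (by omega) (hlow₂ x hx i)
  · rw [Pi.smul_apply, smul_eq_mul, zpow_mul_mem_iff]
    exact maxPow_mono (by push_cast; omega) (hlow₁ x hx i)

/-- The matrix of `X` with respect to the basis `e`. -/
noncomputable abbrev matrixIn (e : Module.Basis (Fin 2) K (Fin 2 → K))
    (X : Matrix (Fin 2) (Fin 2) K) : Matrix (Fin 2) (Fin 2) K :=
  LinearMap.toMatrix e e (Matrix.toLin' X)

theorem repr_mulVec (e : Module.Basis (Fin 2) K (Fin 2 → K)) (X : Matrix (Fin 2) (Fin 2) K)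
    (x : Fin 2 → K) (i : Fin 2) :
    e.repr (X.mulVec x) i =
      matrixIn e X i 0 * e.repr x 0 + matrixIn e X i 1 * e.repr x 1 := by
  have := congrFun (LinearMap.toMatrix_mulVec_repr e e (Matrix.toLin' X) x) i
  rw [Matrix.toLin'_apply] at this
  rw [← this, Matrix.mulVec, dotProduct, Fin.sum_univ_two]

/-- Constraints on the Hermite form of a lattice whose distance to both ends of a path of length
`D` in the apartment of `e` is at most `D`. -/
theorem hermite_form_bounds {e : Module.Basis (Fin 2) K (Fin 2 → K)} {L₁ L₂ L : Lattice O K 2}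
    {D : ℕ} {m : ℤ} {c : K}
    (hL₁ : ∀ x, x ∈ L₁.1 ↔ e.repr x 0 ∈ maxPow O K 0 ∧ e.repr x 1 ∈ maxPow O K 0)
    (hL₂ : ∀ x, x ∈ L₂.1 ↔ e.repr x 0 ∈ maxPow O K 0 ∧ e.repr x 1 ∈ maxPow O K D)
    (hL : ∀ x, x ∈ L.1 ↔
      e.repr x 1 ∈ maxPow O K 0 ∧ e.repr x 0 - c * e.repr x 1 ∈ maxPow O K m)
    (h₁ : dist L₁.cls L.cls ≤ D) (h₂ : dist L₂.cls L.cls ≤ D) :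
    -D ≤ m ∧ m ≤ 0 ∧ c * unif O K ^ (D : ℤ) ∈ maxPow O K 0 ∧
      c * c * unif O K ^ (D : ℤ) ∈ maxPow O K m := by
  have hv : c • e 0 + (1 : K) • e 1 ∈ L.1 := by
    rw [hL, repr_add_zero, repr_add_one, mul_one, sub_self]
    exact ⟨one_mem_maxPow, zero_mem_maxPow m⟩
  have hw : unif O K ^ m • e 0 + (0 : K) • e 1 ∈ L.1 := by
    rw [hL, repr_add_zero, repr_add_one, mul_zero, sub_zero]
    exact ⟨zero_mem_maxPow 0, unif_zpow_mem m⟩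
  obtain ⟨t, ht, ht'⟩ := dist_cls_le_iff.1 h₁
  obtain ⟨t₂, ht₂, ht₂'⟩ := dist_cls_le_iff.1 h₂
  have hz : unif O K ^ t * unif O K ^ ((D : ℤ) - t) = unif O K ^ (D : ℤ) := by
    rw [← zpow_add₀ (unif_ne_zero O K), add_sub_cancel]
  have a₁ := ht _ hv
  have a₂ := ht _ hw
  have a₃ := ht' ((0 : K) • e 0 + (1 : K) • e 1) ((hL₁ _).2 (by
    rw [repr_add_zero, repr_add_one]
    exact ⟨zero_mem_maxPow 0, one_mem_maxPow⟩))
  have b₁ := ht₂ _ hv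
  have b₂ := ht₂' ((1 : K) • e 0 + (0 : K) • e 1) ((hL₂ _).2 (by
    rw [repr_add_zero, repr_add_one]
    exact ⟨one_mem_maxPow, zero_mem_maxPow _⟩))
  rw [hL₁, repr_zpow_smul, repr_zpow_smul, repr_add_zero, repr_add_one, mul_one,
    unif_zpow_mem_iff] at a₁
  rw [hL₁, repr_zpow_smul, repr_add_zero, ← zpow_add₀ (unif_ne_zero O K), unif_zpow_mem_iff] at a₂
  rw [hL, repr_zpow_smul, repr_zpow_smul, repr_add_zero, repr_add_one, mul_one, mul_zero, zero_sub,
    unif_zpow_mem_iff] at a₃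
  rw [hL₂, repr_zpow_smul, repr_zpow_smul, repr_add_zero, repr_add_one, mul_one,
    unif_zpow_mem_iff] at b₁
  rw [hL, repr_zpow_smul, repr_zpow_smul, repr_add_zero, repr_add_one, mul_one, mul_zero, mul_zero,
    sub_zero, unif_zpow_mem_iff] at b₂
  have a₄ : c * unif O K ^ ((D : ℤ) - t) ∈ maxPow O K m := by
    simpa using sub_mem_maxPow (zero_mem_maxPow m) a₃.2
  -- L₁ gives m ≥ -t ≥ -D, and L₂ gives m ≤ D - t₂ ≤ 0. The bound on c² is the product of cπ^t ∈ O
  -- and cπ^(D-t) ∈ 𝔪^m.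
  refine ⟨by omega, by omega, ?_, ?_⟩
  · have := mul_mem_maxPow a₁.1 (unif_zpow_mem (O := O) (K := K) (D - t)) (c := 0) (by omega)
    rwa [mul_right_comm, hz, mul_comm] at this
  · have := mul_mem_maxPow a₁.1 a₄ (c := m) (by omega)
    rwa [← hz, show c * c * (unif O K ^ t * unif O K ^ ((D : ℤ) - t)) =
      unif O K ^ t * c * (c * unif O K ^ ((D : ℤ) - t)) by ring]

/-- The entry bounds are those of π^r Λ(M). Writing x = y(ce₀ + e₁) + ze₀, each monomial in the
coordinates of Xx is controlled separately. -/
theorem mulVec_mem_of_hermite_form {e : Module.Basis (Fin 2) K (Fin 2 → K)} {L : Lattice O K 2}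
    {D r : ℕ} {m : ℤ} {c : K} {X : Matrix (Fin 2) (Fin 2) K}
    (hL : ∀ x, x ∈ L.1 ↔
      e.repr x 1 ∈ maxPow O K 0 ∧ e.repr x 0 - c * e.repr x 1 ∈ maxPow O K m)
    (hm : -D ≤ m) (hm0 : m ≤ 0) (hc : c * unif O K ^ (D : ℤ) ∈ maxPow O K 0)
    (hcc : c * c * unif O K ^ (D : ℤ) ∈ maxPow O K m)
    (hcr : c * unif O K ^ (r : ℤ) ∈ maxPow O K m)
    (h00 : matrixIn e X 0 0 ∈ maxPow O K r) (h01 : matrixIn e X 0 1 ∈ maxPow O K 0)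
    (h10 : matrixIn e X 1 0 ∈ maxPow O K D) (h11 : matrixIn e X 1 1 ∈ maxPow O K r)
    {x : Fin 2 → K} (hx : x ∈ L.1) : X.mulVec x ∈ L.1 := by
  obtain ⟨hx1, hz⟩ := (hL x).1 hx
  rw [hL, repr_mulVec, repr_mulVec]
  set A := matrixIn e X
  set z := e.repr x 0 - c * e.repr x 1 with hzdef
  set y := e.repr x 1
  have hx0 : e.repr x 0 = c * y + z := by rw [hzdef]; ring
  have key : ∀ {n k : ℤ} {a b : K}, a ∈ maxPow O K n → b * unif O K ^ n ∈ maxPow O K k →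
      b * a ∈ maxPow O K k := by
    intro n k a b ha hb
    obtain ⟨a', rfl⟩ := mem_maxPow.1 ha
    rw [mul_left_comm]
    exact mul_mem_maxPow (algebraMap_mem a') hb (by omega)
  have c10 : c * A 1 0 ∈ maxPow O K 0 := key h10 hc
  have cc10 : c * c * A 1 0 ∈ maxPow O K m := key h10 hcc
  have c00 : c * A 0 0 ∈ maxPow O K m := key h00 hcr
  have c11 : c * A 1 1 ∈ maxPow O K m := key h11 hcr
  rw [hx0]
  constructor
  · rw [show A 1 0 * (c * y + z) + A 1 1 * y = c * A 1 0 * y + A 1 0 * z + A 1 1 * y by ring]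
    exact add_mem_maxPow (add_mem_maxPow (mul_mem_maxPow c10 hx1 (by omega))
      (mul_mem_maxPow h10 hz (by omega))) (mul_mem_maxPow h11 hx1 (by omega))
  · rw [show A 0 0 * (c * y + z) + A 0 1 * y - c * (A 1 0 * (c * y + z) + A 1 1 * y) =
      c * A 0 0 * y + A 0 0 * z + A 0 1 * y - (c * c * A 1 0 * y + c * A 1 0 * z +
        c * A 1 1 * y) by ring]
    refine sub_mem_maxPow (add_mem_maxPow (add_mem_maxPow ?_ ?_) ?_)
      (add_mem_maxPow (add_mem_maxPow ?_ ?_) ?_)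
    · exact mul_mem_maxPow c00 hx1 (by omega)
    · exact mul_mem_maxPow h00 hz (by omega)
    · exact mul_mem_maxPow h01 hx1 (by omega)
    · exact mul_mem_maxPow cc10 hx1 (by omega)
    · exact mul_mem_maxPow c10 hz (by omega)
    · exact mul_mem_maxPow c11 hx1 (by omega)

theorem exists_max_dist {Λ : Subalgebra O (Matrix (Fin 2) (Fin 2) K)} (hΛ : IsOrder Λ) :
    ∃ L₁ L₂ : Lattice O K 2, IsInvariant Λ L₁ ∧ IsInvariant Λ L₂ ∧
      ∀ N₁ N₂ : Lattice O K 2, IsInvariant Λ N₁ → IsInvariant Λ N₂ →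
        dist N₁.cls N₂.cls ≤ dist L₁.cls L₂.cls := by
  obtain ⟨B, hB⟩ := exists_dist_bound hΛ
  obtain ⟨L, hL⟩ := exists_invariant hΛ
  let T : Set ℕ := {n | ∃ L₁ L₂ : Lattice O K 2, IsInvariant Λ L₁ ∧ IsInvariant Λ L₂ ∧
    dist L₁.cls L₂.cls = n}
  have hbdd : BddAbove T := ⟨B, by
    rintro _ ⟨L₁, L₂, h₁, h₂, rfl⟩
    exact hB L₁ L₂ h₁ h₂⟩
  obtain ⟨L₁, L₂, h₁, h₂, h⟩ := Nat.sSup_mem (s := T) ⟨_, L, L, hL, hL, rfl⟩ hbdd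
  refine ⟨L₁, L₂, h₁, h₂, fun N₁ N₂ k₁ k₂ => ?_⟩
  rw [h]
  exact le_csSup hbdd ⟨N₁, N₂, k₁, k₂, rfl⟩

theorem IsPZClosed.isBolytrope {S : Set (Vertex O K 2)} (h : IsPZClosed S) : IsBolytrope S := by
  obtain ⟨Λ, hΛ, rfl⟩ := h
  obtain ⟨L₁, L₂', hL₁inv, hL₂inv', hmax⟩ := exists_max_dist hΛ
  obtain ⟨e, L₂, hcls, hL₁, hL₂⟩ := exists_adapted_basis L₁ L₂'
  have hL₂inv : IsInvariant Λ L₂ := hL₂inv'.of_cls_eq hcls.symm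
  set D := dist L₁.cls L₂'.cls
  -- The first column is read off from e₀ ∈ L₂, the second from e₁ ∈ L₁.
  have hA : ∀ X ∈ Λ, matrixIn e X 0 0 ∈ maxPow O K 0 ∧ matrixIn e X 0 1 ∈ maxPow O K 0 ∧
      matrixIn e X 1 0 ∈ maxPow O K D ∧ matrixIn e X 1 1 ∈ maxPow O K 0 := by
    intro X hX
    have h0 := hL₂inv X hX ((1 : K) • e 0 + (0 : K) • e 1) ((hL₂ _).2 (by
      rw [repr_add_zero, repr_add_one]
      exact ⟨one_mem_maxPow, zero_mem_maxPow _⟩))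
    have h1 := hL₁inv X hX ((0 : K) • e 0 + (1 : K) • e 1) ((hL₁ _).2 (by
      rw [repr_add_zero, repr_add_one]
      exact ⟨zero_mem_maxPow _, one_mem_maxPow⟩))
    rw [hL₂, repr_mulVec, repr_mulVec, repr_add_zero, repr_add_one] at h0
    rw [hL₁, repr_mulVec, repr_mulVec, repr_add_zero, repr_add_one] at h1
    simp only [mul_one, mul_zero, add_zero, zero_add] at h0 h1
    exact ⟨h0.1, h1.1, h0.2, h1.2⟩
  let P : ℕ → Prop := fun s => ∀ X ∈ Λ, matrixIn e X 0 0 - matrixIn e X 1 1 ∈ maxPow O K s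
  -- The cap 2r ≤ D is the triangle inequality M₀₁ + M₁₀ ≥ 0. The search stops at the cap, where D ≤
  -- 2r + 1, or because r + 1 fails.
  obtain ⟨r, hr, hrD, hrmax⟩ : ∃ r : ℕ, P r ∧ 2 * r ≤ D ∧ (D ≤ 2 * r + 1 ∨ ¬ P (r + 1)) := by
    classical
    have h0 : P 0 := fun X hX => sub_mem_maxPow (hA X hX).1 (hA X hX).2.2.2
    refine ⟨Nat.findGreatest P (D / 2), Nat.findGreatest_spec (Nat.zero_le _) h0, ?_, ?_⟩
    · have := Nat.findGreatest_le (P := P) (D / 2)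
      omega
    · by_cases hlt : D ≤ 2 * Nat.findGreatest P (D / 2) + 1
      · exact Or.inl hlt
      · exact Or.inr (Nat.findGreatest_is_greatest (Nat.lt_succ_self _) (by omega))
  let M : Matrix (Fin 2) (Fin 2) ℤ := !![0, -r; D - r, 0]
  have hM : M ∈ exponentMatrices 2 := by
    refine ⟨fun i => by fin_cases i <;> rfl, fun i j k => ?_⟩
    fin_cases i <;> fin_cases j <;> fin_cases k <;> simp [M] <;> omega
  refine ⟨e, M, hM, r, ?_⟩
  ext v
  constructor
  · rintro ⟨L₀, rfl, hL₀⟩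
    obtain ⟨L, hLcls, m, c, hL⟩ := exists_scaled_hermite_form e L₀
    have hLinv : IsInvariant Λ L := hL₀.of_cls_eq hLcls.symm
    rw [← hLcls, cls_mem_closedBall_iff (isOrder_graduatedOrder e M hM).fg]
    obtain ⟨hm, hm0, hc, hcc⟩ := hermite_form_bounds hL₁ hL₂ hL (hmax _ _ hL₁inv hLinv)
      (hmax _ _ hL₂inv hLinv)
    have hcr : c * unif O K ^ (r : ℤ) ∈ maxPow O K m := by
      rcases hrmax with hr' | hr'
      · exact mem_of_sq_mul_mem hm0 (by omega) hcc
      · simp only [P, not_forall] at hr'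
        obtain ⟨X, hX, hδ⟩ := hr'
        obtain ⟨-, h01, h10, -⟩ := hA X hX
        have hv := hLinv X hX (c • e 0 + (1 : K) • e 1) ((hL _).2 (by
          rw [repr_add_zero, repr_add_one, mul_one, sub_self]
          exact ⟨one_mem_maxPow, zero_mem_maxPow m⟩))
        rw [hL, repr_mulVec, repr_mulVec, repr_add_zero, repr_add_one] at hv
        -- X(ce₀ + e₁) ∈ L reads c(X₀₀ - X₁₁) + X₀₁ - c²X₁₀ ∈ 𝔪^m, and the last two terms already
        -- lie in 𝔪^m.
        have hcδ : c * (matrixIn e X 0 0 - matrixIn e X 1 1) ∈ maxPow O K m := by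
          obtain ⟨a, ha⟩ := mem_maxPow.1 h10
          have := add_mem_maxPow (sub_mem_maxPow hv.2 (maxPow_mono hm0 h01))
            (mul_mem_maxPow (algebraMap_mem a) hcc (c := m) (by omega))
          convert this using 1
          rw [ha]
          ring
        have hδr := hr X hX
        obtain ⟨u, k, hu⟩ := exists_eq_unit_mul_zpow (O := O)
          (fun h0 => hδ (h0 ▸ zero_mem_maxPow _) : matrixIn e X 0 0 - matrixIn e X 1 1 ≠ 0)
        rw [hu, unit_mul_mem_iff, unif_zpow_mem_iff] at hδ hδr
        have hk : k = r := by omega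
        rwa [hu, hk, mul_left_comm, unit_mul_mem_iff] at hcδ
    intro Y hY x hx
    rw [← Matrix.smul_mulVec]
    have hsm : ∀ i j, matrixIn e (unif O K ^ (r : ℤ) • Y) i j =
        unif O K ^ (r : ℤ) * matrixIn e Y i j := fun i j => by
      rw [matrixIn, map_smul, map_smul, Matrix.smul_apply, smul_eq_mul]
    refine mulVec_mem_of_hermite_form (D := D) (r := r) hL hm hm0 hc hcc hcr ?_ ?_ ?_ ?_ hx
    all_goals rw [hsm, zpow_mul_mem_iff]
    · exact maxPow_mono (by simp [M]) (hY 0 0)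
    · exact maxPow_mono (by simp [M]) (hY 0 1)
    · exact maxPow_mono (by simp [M]) (hY 1 0)
    · exact maxPow_mono (by simp [M]) (hY 1 1)
  · obtain ⟨L, rfl⟩ := Quotient.exists_rep v
    change L.cls ∈ _ → L.cls ∈ _
    rw [cls_mem_closedBall_iff (isOrder_graduatedOrder e M hM).fg, cls_mem_invariantClasses_iff]
    intro h X hX x hx
    obtain ⟨h00, h01, h10, h11⟩ := hA X hX
    set a := matrixIn e X 1 1 with ha
    -- X = a + π^r Y with a = X₁₁ integral and Y in Λ(M), which exhibits Λ ⊆ O + π^r Λ(M).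
    have hY : unif O K ^ (-r : ℤ) • (X - a • 1) ∈ graduatedOrder (O := O) e M hM := by
      have hentry : ∀ i j, matrixIn e (unif O K ^ (-r : ℤ) • (X - a • 1)) i j =
          unif O K ^ (-r : ℤ) * (matrixIn e X i j - a * (1 : Matrix (Fin 2) (Fin 2) K) i j) := by
        intro i j
        simp only [matrixIn, map_smul, map_sub, Matrix.toLin'_one, LinearMap.toMatrix_id,
          Matrix.smul_apply, Matrix.sub_apply, smul_eq_mul]
      intro i j
      change matrixIn e _ i j ∈ _
      rw [hentry, zpow_mul_mem_iff]
      fin_cases i <;> fin_cases j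
      · simpa [M] using hr X hX
      · simpa [M] using h01
      · simpa [M] using h10
      · simpa [M, ← ha] using zero_mem_maxPow (O := O) (K := K) (r : ℤ)
    have h1 := h _ hY x hx
    rw [Matrix.smul_mulVec, zpow_smul_zpow_smul, add_neg_cancel, zpow_zero, one_smul,
      Matrix.sub_mulVec, Matrix.smul_mulVec, Matrix.one_mulVec] at h1
    have h2 := L.1.add_mem h1 (smul_mem_of_mem_maxPow h11 hx)
    rwa [sub_add_cancel] at h2

end Main

end BolytropeOrders

theorem mainTheorem9 (O : Type*) [CommRing O] [IsDomain O] [IsDiscreteValuationRing O]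
    (K : Type*) [Field K] [Algebra O K] [IsFractionRing O K]
    (S : Set (BolytropeOrders.Vertex O K 2)) :
    BolytropeOrders.IsPZClosed S ↔ BolytropeOrders.IsBolytrope S := by
  exact ⟨BolytropeOrders.IsPZClosed.isBolytrope, BolytropeOrders.IsBolytrope.isPZClosed⟩
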